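/- For real $s$, let $\dot H^s(\mathbb{R}^2)$ be the space of tempered distributions $u$ on $\mathbb{R}^2$ whose Fourier transform $\hat u$ belongs to $L^1_{loc}(\mathbb{R}^2)$ and satisfies $$\|u\|_{\dot H^s} := \Big(\int_{\mathbb{R}^2} |\xi|^{2s}\,|\hat u(\xi)|^2\,d\xi\Big)^{1/2} < \infty .$$ For tempered distributions $a,b$ with locally integrable Fourier transforms, the product $ab$ is the tempered distribution $\lim_{j\to\infty} (S_j a)(S_j b)$, where $S_j u := \mathcal{F}^{-1}\big(\chi(2^{-j}\cdot)\,\hat u\big)$ is a bounded continuous function; the product is said to exist if this limit exists in $\mathcal{S}'(\mathbb{R}^2)$ for every smooth compactly supported $\chi:\mathbb{R}^2\to\mathbb{R}$ equal to $1$ near the origin, and is the same for all such $\chi$. Theorem. Let $s,t$ be real numbers with $|s|<1$, $|t|<1$ and $s+t>0$. There is a constant $C>0$, depending only on $s$ and $t$, such that for every $a\in\dot H^s(\mathbb{R}^2)$ and every $b\in\dot H^t(\mathbb{R}^2)$ the product $ab$ exists, belongs to $\dot H^{s+t-1}(\mathbb{R}^2)$, and satisfies $$\|ab\|_{\dot H^{s+t-1}}\le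 C\,\|a\|_{\dot H^s}\,\|b\|_{\dot H^t}.$$ -/

import Mathlib

open MeasureTheory Filter Topology FourierTransform
open scoped SchwartzMap ContDiff

noncomputable section

/-- The plane `ℝ²` with its Euclidean norm. -/
abbrev Plane : Type := EuclideanSpace ℝ (Fin 2)

/-- `f ∈ L¹_loc(ℝ²)` and the Fourier transform of the tempered distribution `u` is the function `f`,
in the sense of distributions (pairing with compactly supported smooth functions). -/
def IsFourierFunction (u : 𝓢'(Plane, ℂ)) (f : Plane → ℂ) : Prop :=
  LocallyIntegrable f volume ∧
    ∀ φ : 𝓢(Plane, ℂ), HasCompactSupport (φ : Plane → ℂ) →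
      (𝓕 u : 𝓢'(Plane, ℂ)) φ = ∫ ξ, φ ξ * f ξ

/-- The Fourier transform of `u` belongs to `L¹_loc(ℝ²)`. -/
def FourierLocallyIntegrable (u : 𝓢'(Plane, ℂ)) : Prop :=
  ∃ f : Plane → ℂ, IsFourierFunction u f

open Classical in
/-- The Fourier transform `û` as a locally integrable function (determined almost everywhere);
by convention it is `0` if the Fourier transform of `u` is not in `L¹_loc(ℝ²)`. -/
def fourierFunction (u : 𝓢'(Plane, ℂ)) : Plane → ℂ :=
  if h : FourierLocallyIntegrable u then h.choose else 0

/-- `u ∈ Ḣ^s(ℝ²)`: the Fourier transform of `u` is in `L¹_loc` and `∫ |ξ|^{2s} |û(ξ)|² dξ < ∞`. -/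
def MemHomSobolev (s : ℝ) (u : 𝓢'(Plane, ℂ)) : Prop :=
  FourierLocallyIntegrable u ∧
    Integrable (fun ξ : Plane => ‖ξ‖ ^ (2 * s) * ‖fourierFunction u ξ‖ ^ 2) volume

/-- The norm `‖u‖_{Ḣ^s} = (∫ |ξ|^{2s} |û(ξ)|² dξ)^{1/2}` (meaningful for `u ∈ Ḣ^s(ℝ²)`). -/
def homSobolevNorm (s : ℝ) (u : 𝓢'(Plane, ℂ)) : ℝ :=
  Real.sqrt (∫ ξ : Plane, ‖ξ‖ ^ (2 * s) * ‖fourierFunction u ξ‖ ^ 2)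

/-- A frequency cut-off: a smooth compactly supported function, equal to `1` near the origin. -/
structure IsFrequencyCutoff (χ : Plane → ℝ) : Prop where
  contDiff : ContDiff ℝ ∞ χ
  hasCompactSupport : HasCompactSupport χ
  eventually_eq_one : ∀ᶠ ξ in 𝓝 (0 : Plane), χ ξ = 1

/-- The low-frequency part `S_j u = 𝓕⁻¹ (χ(2^{-j} ·) û)`. If `û ∈ L¹_loc(ℝ²)`, then
`χ(2^{-j} ·) û` is integrable, so that `S_j u` is a bounded continuous function. -/
def lowFrequency (χ : Plane → ℝ) (j : ℕ) (u : 𝓢'(Plane, ℂ)) : Plane → ℂ :=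
  𝓕⁻ (fun ξ : Plane => (χ ((2 : ℝ)⁻¹ ^ j • ξ) : ℂ) * fourierFunction u ξ)

/-- `c` is the product `a b` of the tempered distributions `a` and `b`: for every frequency cut-off,
the pointwise products `S_j a · S_j b` of the low-frequency parts converge to `c` in `𝓢'(ℝ²)`
as `j → ∞`. -/
def IsDistribProduct (a b c : 𝓢'(Plane, ℂ)) : Prop :=
  FourierLocallyIntegrable a ∧ FourierLocallyIntegrable b ∧
    ∀ χ : Plane → ℝ, IsFrequencyCutoff χ → ∀ φ : 𝓢(Plane, ℂ),
      Tendsto (fun j : ℕ => ∫ x, φ x * (lowFrequency χ j a x * lowFrequency χ j b x))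
        atTop (𝓝 (c φ))

theorem exists_isFrequencyCutoff : ∃ χ : Plane → ℝ, IsFrequencyCutoff χ := by
  let f : ContDiffBump (0 : Plane) := ⟨1, 2, one_pos, one_lt_two⟩
  exact ⟨f, f.contDiff, f.hasCompactSupport, f.eventuallyEq_one⟩

/-- The product is unique. -/
theorem IsDistribProduct.unique {a b c c' : 𝓢'(Plane, ℂ)} (h : IsDistribProduct a b c)
    (h' : IsDistribProduct a b c') : c = c' := by
  obtain ⟨χ, hχ⟩ := exists_isFrequencyCutoff
  ext φ
  exact tendsto_nhds_unique (h.2.2 χ hχ φ) (h'.2.2 χ hχ φ)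

end

/-!
The Fourier transform of the product is the convolution `f ∗ g` of the Fourier transforms, so the
theorem comes down to the weighted estimate
`‖ |ξ| ^ (s + t - 1) (f ∗ g) ‖ ≤ C ‖ |ξ| ^ s f ‖ ‖ |ξ| ^ t g ‖` in `L²` of the plane
(`exists_lintegral_powWeight_convolution_le`), together with the verification that the convolution
defines a tempered distribution and that the truncated products converge to it.

For the estimate, write `F = |ξ| ^ s |f|`, `G = |ξ| ^ t |g|`. In `x + y = z` the two largest of the
three frequencies are comparable, so that the weight `|z| ^ (s + t - 1) |x| ^ (-s) |y| ^ (-t)` is at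
most twice one of three kernels `k r x z = |x| ^ (-r) |z| ^ (r - 1)` on `|x| ≤ |z|`, evaluated at the
smallest frequency and at one of the other two, with `r = s`, `t` or `1 - s - t`
(`powWeight_mul_mul_le`). All three values of `r` are below `1`, whence `∫ k r x z ^ 2 dx` is finite,
and it does not depend on `z` by homogeneity (`exists_lintegral_smallKernel_sq_le`). A single
application of Cauchy–Schwarz in the convolution integral then suffices in each region. If one of
the factors has the smallest frequency, the kernel is separated from `F(x) G(z - x)`, and Tonelli's
theorem gives `∬ F(x)² G(z - x)² = ‖F‖² ‖G‖²` (`lintegral_sq_input_smallKernel_le`). If the product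
has the smallest frequency, `F` is separated from `G` times the kernel, which is then integrated in
the output variable (`lintegral_sq_output_smallKernel_le`).

The same estimate applied to `|f| ∗ |g|` shows that this function is in a weighted `L²` space, hence
integrable against `(1 + |ξ|) ^ (-3)` (`lintegral_inv_one_add_norm_pow_mul_lt_top`). Therefore
`f ∗ g` converges absolutely almost everywhere, is locally integrable and defines a tempered
distribution. The pairing of the truncated products with `φ` equals the pairing of the convolution
of the truncated transforms with `𝓕⁻ φ` (`integral_mul_fourierInv_mul_fourierInv`), and `|f| ∗ |g|`
is the dominating function for the passage to the limit
(`tendsto_integral_schwartz_mul_truncated_convolution`).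
-/

open scoped ENNReal

/-! ### Power weights -/

/-- The power weight `‖x‖ ^ r`, with values in `[0, ∞]`. Its value at the origin is irrelevant, since
the origin is a null set. -/
noncomputable def powWeight (r : ℝ) (x : Plane) : ℝ≥0∞ := ENNReal.ofReal (‖x‖ ^ r)

@[fun_prop]
theorem measurable_powWeight (r : ℝ) : Measurable (powWeight r) := by
  unfold powWeight; fun_prop

theorem powWeight_mul_powWeight {x : Plane} (hx : x ≠ 0) (r r' : ℝ) :
    powWeight r x * powWeight r' x = powWeight (r + r') x := by
  have := norm_pos_iff.2 hx
  rw [powWeight, powWeight, powWeight, ← ENNReal.ofReal_mul (by positivity), Real.rpow_add this]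

theorem powWeight_zero_exponent (x : Plane) : powWeight 0 x = 1 := by simp [powWeight]

theorem powWeight_sq (r : ℝ) (x : Plane) : powWeight r x ^ 2 = powWeight (2 * r) x := by
  rw [powWeight, powWeight, ← ENNReal.ofReal_pow (by positivity), mul_comm 2 r,
    Real.rpow_mul (norm_nonneg x), Real.rpow_ofNat]

theorem powWeight_neg_mul_cancel {x : Plane} (hx : x ≠ 0) (r : ℝ) (c : ℝ≥0∞) :
    powWeight (-r) x * (powWeight r x * c) = c := by
  rw [← mul_assoc, powWeight_mul_powWeight hx, neg_add_cancel, powWeight_zero_exponent, one_mul]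

theorem setLIntegral_closedBall_powWeight_lt_top {r : ℝ} (hr : -2 < r) :
    ∫⁻ x in Metric.closedBall 0 1, powWeight r x < ⊤ := by
  have h : IntegrableOn (fun x : Plane => ‖x‖ ^ r) (Metric.ball 0 2) volume := by
    rw [integrableOn_fun_norm_addHaar volume (f := fun y => y ^ r)]
    have h2 : IntegrableOn (fun y : ℝ => y ^ (r + 1)) (Set.Ioo 0 2) volume :=
      (intervalIntegral.integrableOn_Ioo_rpow_iff two_pos).2 (by linarith)
    refine h2.congr_fun (fun y hy => ?_) measurableSet_Ioo
    simp [Real.rpow_add_one hy.1.ne', mul_comm]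
  have h' := (h.mono_set (Metric.closedBall_subset_ball one_lt_two)).lintegral_lt_top
  simpa [powWeight] using h'

/-- The kernel `‖x‖ ^ (-r) * ‖z‖ ^ (r - 1)`, restricted to `‖x‖ ≤ ‖z‖`. It is homogeneous of degree
`-1`, which makes its `L²` norm in `x` scale invariant in dimension two. -/
noncomputable def smallKernel (r : ℝ) (x z : Plane) : ℝ≥0∞ :=
  if ‖x‖ ≤ ‖z‖ then powWeight (-r) x * powWeight (r - 1) z else 0

@[fun_prop]
theorem Measurable.smallKernel {α : Type*} [MeasurableSpace α] (r : ℝ) {u v : α → Plane}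
    (hu : Measurable u) (hv : Measurable v) : Measurable fun a => smallKernel r (u a) (v a) := by
  unfold _root_.smallKernel
  exact Measurable.ite (measurableSet_le (by fun_prop) (by fun_prop)) (by fun_prop) (by fun_prop)

theorem lintegral_comp_smul_plane (f : Plane → ℝ≥0∞) {R : ℝ} (hR : 0 < R) :
    ∫⁻ x, f x = ENNReal.ofReal (R ^ 2) * ∫⁻ x, f (R • x) := by
  have h : ∫⁻ x, f x ∂(Measure.map (fun x : Plane => R • x) volume) = ∫⁻ x, f (R • x) :=
    (measurableEmbedding_const_smul₀ hR.ne').lintegral_map f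
  rw [← h, Measure.map_addHaar_smul volume hR.ne', lintegral_smul_measure, smul_eq_mul, ← mul_assoc,
    ← ENNReal.ofReal_mul (by positivity)]
  simp [abs_of_pos, hR.ne', hR]

/-- By homogeneity, the square of `smallKernel r · z` has an integral that does not depend on
`z ≠ 0`; it is finite because `‖x‖ ^ (-2 * r)` is integrable at the origin of the plane. -/
theorem exists_lintegral_smallKernel_sq_le {r : ℝ} (hr : r < 1) :
    ∃ K : ℝ≥0∞, K ≠ ⊤ ∧ ∀ z : Plane, ∫⁻ x, smallKernel r x z ^ 2 ≤ K := by
  refine ⟨∫⁻ x in Metric.closedBall 0 1, powWeight (2 * -r) x,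
    (setLIntegral_closedBall_powWeight_lt_top (by linarith)).ne, fun z => ?_⟩
  rcases eq_or_ne z 0 with rfl | hz
  · have h : (fun x : Plane => smallKernel r x 0 ^ 2) =ᵐ[volume] 0 := by
      filter_upwards [volume.ae_ne (0 : Plane)] with x hx
      simp [smallKernel, hx]
    rw [lintegral_congr_ae h]
    simp
  · have hR := norm_pos_iff.2 hz
    rw [lintegral_comp_smul_plane _ hR,
      ← lintegral_indicator Metric.isClosed_closedBall.measurableSet,
      ← lintegral_const_mul' _ _ ENNReal.ofReal_ne_top]
    refine lintegral_mono fun x => ?_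
    by_cases hx : ‖x‖ ≤ 1
    · have h1 : ‖‖z‖ • x‖ ≤ ‖z‖ := by
        rw [norm_smul, norm_norm]; exact mul_le_of_le_one_right hR.le hx
      have h2 : x ∈ Metric.closedBall (0 : Plane) 1 := by simpa using hx
      rw [smallKernel, if_pos h1, Set.indicator_of_mem h2, mul_pow, powWeight_sq, powWeight_sq]
      simp only [powWeight, norm_smul, norm_norm]
      rw [← ENNReal.ofReal_mul (by positivity), ← ENNReal.ofReal_mul (by positivity),
        Real.mul_rpow hR.le (norm_nonneg x)]
      apply le_of_eq
      congr 1
      have : ‖z‖ ^ 2 * (‖z‖ ^ (2 * -r) * ‖z‖ ^ (2 * (r - 1))) = 1 := by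
        rw [← Real.rpow_natCast, ← Real.rpow_add hR, ← Real.rpow_add hR]
        ring_nf; simp
      linear_combination ‖x‖ ^ (2 * -r) * this
    · have h1 : ¬ ‖‖z‖ • x‖ ≤ ‖z‖ := by
        rw [norm_smul, norm_norm]; nlinarith
      simp [smallKernel, h1]

/-! ### The weighted convolution estimate -/

theorem lintegral_mul_sq_le {α : Type*} [MeasurableSpace α] {μ : Measure α} {f g : α → ℝ≥0∞}
    (hf : Measurable f) (hg : Measurable g) :
    (∫⁻ x, f x * g x ∂μ) ^ 2 ≤ (∫⁻ x, f x ^ 2 ∂μ) * ∫⁻ x, g x ^ 2 ∂μ := by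
  have h := ENNReal.lintegral_mul_le_Lp_mul_Lq μ Real.HolderConjugate.two_two
    hf.aemeasurable hg.aemeasurable
  simp only [Pi.mul_apply, ENNReal.rpow_ofNat] at h
  calc _ ≤ _ := pow_le_pow_left' h 2
    _ = _ := by
      rw [mul_pow, ← ENNReal.rpow_natCast, ← ENNReal.rpow_natCast, ← ENNReal.rpow_mul,
        ← ENNReal.rpow_mul]
      simp

theorem lintegral_lintegral_convolution {F G : Plane → ℝ≥0∞} (hF : Measurable F)
    (hG : Measurable G) :
    ∫⁻ z, ∫⁻ x, F x * G (z - x) = (∫⁻ x, F x) * ∫⁻ x, G x := by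
  rw [lintegral_lintegral_swap (by fun_prop)]
  have h (x : Plane) : ∫⁻ z, F x * G (z - x) = F x * ∫⁻ z, G z := by
    rw [lintegral_const_mul _ (by fun_prop), lintegral_sub_right_eq_self]
  simp_rw [h]
  rw [lintegral_mul_const _ hF]

/-- The contribution of the frequencies where one of the factors has the smallest frequency. -/
theorem lintegral_sq_input_smallKernel_le {r : ℝ} {K : ℝ≥0∞}
    (hK : ∀ z : Plane, ∫⁻ x, smallKernel r x z ^ 2 ≤ K) {F G : Plane → ℝ≥0∞}
    (hF : Measurable F) (hG : Measurable G) :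
    ∫⁻ z, (∫⁻ x, F x * G (z - x) * smallKernel r x z) ^ 2 ≤
      K * ((∫⁻ x, F x ^ 2) * ∫⁻ x, G x ^ 2) := by
  calc _ ≤ ∫⁻ z, (∫⁻ x, F x ^ 2 * G (z - x) ^ 2) * K := by
        refine lintegral_mono fun z => (lintegral_mul_sq_le (by fun_prop) (by fun_prop)).trans ?_
        simp_rw [mul_pow]
        gcongr
        exact hK z
    _ = _ := by
      rw [lintegral_mul_const _ (Measurable.lintegral_prod_right (by fun_prop)),
        lintegral_lintegral_convolution (hF.pow_const 2)
        (hG.pow_const 2), mul_comm]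

/-- The contribution of the frequencies where the product has the smallest frequency. -/
theorem lintegral_sq_output_smallKernel_le {r : ℝ} {K : ℝ≥0∞}
    (hK : ∀ z : Plane, ∫⁻ x, smallKernel r x z ^ 2 ≤ K) {F G : Plane → ℝ≥0∞}
    (hF : Measurable F) (hG : Measurable G) :
    ∫⁻ z, (∫⁻ x, F x * G (z - x) * smallKernel r z (z - x)) ^ 2 ≤
      K * ((∫⁻ x, F x ^ 2) * ∫⁻ x, G x ^ 2) := by
  calc _ ≤ ∫⁻ z, (∫⁻ x, F x ^ 2) * ∫⁻ y, G y ^ 2 * smallKernel r z y ^ 2 := by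
        refine lintegral_mono fun z => ?_
        simp_rw [mul_assoc]
        refine (lintegral_mul_sq_le (by fun_prop) (by fun_prop)).trans ?_
        rw [lintegral_sub_left_eq_self (fun y => (G y * smallKernel r z y) ^ 2)]
        simp_rw [mul_pow]
        rfl
    _ = (∫⁻ x, F x ^ 2) * ∫⁻ y, G y ^ 2 * ∫⁻ z, smallKernel r z y ^ 2 := by
      rw [lintegral_const_mul _ (Measurable.lintegral_prod_right (by fun_prop)),
        lintegral_lintegral_swap (by fun_prop)]
      congr 1
      refine lintegral_congr fun y => lintegral_const_mul _ (by fun_prop)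
    _ ≤ (∫⁻ x, F x ^ 2) * ∫⁻ y, G y ^ 2 * K := by
      gcongr with y
      exact hK y
    _ = _ := by rw [lintegral_mul_const _ (hG.pow_const 2)]; ring

theorem rpow_neg_le_two_mul_rpow_neg {a b t : ℝ} (ha : 0 < a) (hb : 0 < b) (hab : a ≤ 2 * b)
    (hba : b ≤ 2 * a) (ht : |t| < 1) : a ^ (-t) ≤ 2 * b ^ (-t) := by
  obtain ⟨ht1, ht2⟩ := abs_lt.1 ht
  rcases le_total 0 t with h | h
  · have h1 : (2 * a) ^ (-t) ≤ b ^ (-t) := Real.rpow_le_rpow_of_nonpos hb hba (by linarith)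
    rw [Real.mul_rpow two_pos.le ha.le] at h1
    have h2 : (2 : ℝ) * 2 ^ (-t) ≥ 1 := by
      have : (2 : ℝ) * 2 ^ (-t) = 2 ^ (1 - t) := by
        rw [sub_eq_add_neg, Real.rpow_add two_pos, Real.rpow_one]
      rw [this]; exact Real.one_le_rpow one_le_two (by linarith)
    have : 0 < a ^ (-t) := by positivity
    nlinarith
  · have h1 : a ^ (-t) ≤ (2 * b) ^ (-t) := Real.rpow_le_rpow ha.le hab (by linarith)
    rw [Real.mul_rpow two_pos.le hb.le] at h1
    have h2 : (2 : ℝ) ^ (-t) ≤ 2 := by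
      simpa using Real.rpow_le_rpow_of_exponent_le one_le_two (show -t ≤ 1 by linarith)
    have : 0 < b ^ (-t) := by positivity
    nlinarith

theorem powWeight_neg_le_two_mul {x y : Plane} {t : ℝ} (hx : x ≠ 0) (hy : y ≠ 0)
    (hxy : ‖x‖ ≤ 2 * ‖y‖) (hyx : ‖y‖ ≤ 2 * ‖x‖) (ht : |t| < 1) :
    powWeight (-t) x ≤ 2 * powWeight (-t) y := by
  refine (ENNReal.ofReal_le_ofReal (rpow_neg_le_two_mul_rpow_neg (norm_pos_iff.2 hx)
    (norm_pos_iff.2 hy) hxy hyx ht)).trans_eq ?_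
  rw [ENNReal.ofReal_mul two_pos.le, ENNReal.ofReal_ofNat, powWeight]

/-- Among three frequencies `x + y = z` the two largest have comparable size, so that the weight is
controlled by one of three kernels, according to which frequency is the smallest. -/
theorem powWeight_mul_mul_le {s t : ℝ} (hs : |s| < 1) (ht : |t| < 1) {x y z : Plane} (hx : x ≠ 0)
    (hy : y ≠ 0) (hz : z ≠ 0) (hxyz : x + y = z) :
    powWeight (s + t - 1) z * (powWeight (-s) x * powWeight (-t) y) ≤
      2 * (smallKernel s x z + smallKernel t y z + smallKernel (1 - s - t) z y) := by
  have hn1 : ‖z‖ ≤ ‖x‖ + ‖y‖ := hxyz ▸ norm_add_le x y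
  have hn2 : ‖x‖ ≤ ‖z‖ + ‖y‖ := by simpa [← hxyz] using norm_sub_le z y
  have hn3 : ‖y‖ ≤ ‖z‖ + ‖x‖ := by simpa [← hxyz] using norm_sub_le z x
  have key : (‖x‖ ≤ ‖y‖ ∧ ‖x‖ ≤ ‖z‖) ∨ (‖y‖ ≤ ‖x‖ ∧ ‖y‖ ≤ ‖z‖) ∨ (‖z‖ ≤ ‖x‖ ∧ ‖z‖ ≤ ‖y‖) := by
    rcases le_total ‖x‖ ‖y‖ with h | h <;> rcases le_total ‖y‖ ‖z‖ with h' | h' <;>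
      rcases le_total ‖x‖ ‖z‖ with h'' | h'' <;> grind
  rcases key with ⟨h, h'⟩ | ⟨h, h'⟩ | ⟨h, h'⟩
  · calc _ ≤ powWeight (s + t - 1) z * (powWeight (-s) x * (2 * powWeight (-t) z)) := by
          gcongr
          exact powWeight_neg_le_two_mul hy hz (by linarith) (by linarith) ht
      _ = 2 * (powWeight (-s) x * (powWeight (s + t - 1) z * powWeight (-t) z)) := by ring
      _ = 2 * smallKernel s x z := by
          rw [powWeight_mul_powWeight hz, smallKernel, if_pos h']; ring_nf
      _ ≤ _ := by gcongr; rw [add_assoc]; exact le_self_add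
  · calc _ ≤ powWeight (s + t - 1) z * ((2 * powWeight (-s) z) * powWeight (-t) y) := by
          gcongr
          exact powWeight_neg_le_two_mul hx hz (by linarith) (by linarith) hs
      _ = 2 * (powWeight (-t) y * (powWeight (s + t - 1) z * powWeight (-s) z)) := by ring
      _ = 2 * smallKernel t y z := by
          rw [powWeight_mul_powWeight hz, smallKernel, if_pos h']; ring_nf
      _ ≤ _ := by gcongr; exact le_add_right le_add_self
  · calc _ ≤ powWeight (s + t - 1) z * ((2 * powWeight (-s) y) * powWeight (-t) y) := by
          gcongr
          exact powWeight_neg_le_two_mul hx hy (by linarith) (by linarith) hs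
      _ = 2 * (powWeight (s + t - 1) z * (powWeight (-s) y * powWeight (-t) y)) := by ring
      _ = 2 * smallKernel (1 - s - t) z y := by
          rw [powWeight_mul_powWeight hy, smallKernel, if_pos h']; ring_nf
      _ ≤ _ := by gcongr; exact le_add_self

theorem ENNReal.add_add_sq_le (a b c : ℝ≥0∞) :
    (a + b + c) ^ 2 ≤ 9 * (a ^ 2 + b ^ 2 + c ^ 2) := by
  have h : ∀ m : ℝ≥0∞, a ≤ m → b ≤ m → c ≤ m → (a + b + c) ^ 2 ≤ 9 * m ^ 2 := fun m ha hb hc =>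
    calc (a + b + c) ^ 2 ≤ (m + m + m) ^ 2 := by gcongr
      _ = _ := by ring
  have h9 : ∀ m : ℝ≥0∞, m = a ∨ m = b ∨ m = c → 9 * m ^ 2 ≤ 9 * (a ^ 2 + b ^ 2 + c ^ 2) := by
    rintro m (rfl | rfl | rfl)
    · gcongr; rw [add_assoc]; exact le_self_add
    · gcongr; exact le_add_right le_add_self
    · gcongr; exact le_add_self
  rcases le_total a b with h1 | h1 <;> rcases le_total b c with h2 | h2 <;>
    rcases le_total a c with h3 | h3
  · exact (h c h3 h2 le_rfl).trans (h9 c (by simp))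
  · exact (h c (h1.trans h2) h2 le_rfl).trans (h9 c (by simp))
  · exact (h b h1 le_rfl h2).trans (h9 b (by simp))
  · exact (h b h1 le_rfl h2).trans (h9 b (by simp))
  · exact (h c h3 h2 le_rfl).trans (h9 c (by simp))
  · exact (h a le_rfl h1 h3).trans (h9 a (by simp))
  · exact (h a le_rfl h1 (h2.trans h1)).trans (h9 a (by simp))
  · exact (h a le_rfl h1 h3).trans (h9 a (by simp))

/-- The convolution estimate
`‖ |ξ| ^ (s + t - 1) (f ∗ g) ‖ ≤ C ‖ |ξ| ^ s f ‖ ‖ |ξ| ^ t g ‖` in `L²` of the plane, for nonnegative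
functions. -/
theorem exists_lintegral_powWeight_convolution_le {s t : ℝ} (hs : |s| < 1) (ht : |t| < 1)
    (hst : 0 < s + t) :
    ∃ C : ℝ≥0∞, C ≠ ⊤ ∧ ∀ f g : Plane → ℝ≥0∞, Measurable f → Measurable g →
      ∫⁻ z, (powWeight (s + t - 1) z * ∫⁻ x, f x * g (z - x)) ^ 2 ≤
        C * ((∫⁻ x, (powWeight s x * f x) ^ 2) * ∫⁻ x, (powWeight t x * g x) ^ 2) := by
  obtain ⟨K₁, hK₁, hK₁'⟩ := exists_lintegral_smallKernel_sq_le (abs_lt.1 hs).2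
  obtain ⟨K₂, hK₂, hK₂'⟩ := exists_lintegral_smallKernel_sq_le (abs_lt.1 ht).2
  obtain ⟨K₃, hK₃, hK₃'⟩ := exists_lintegral_smallKernel_sq_le (show 1 - s - t < 1 by linarith)
  refine ⟨36 * (K₁ + K₂ + K₃), by finiteness, fun f g hf hg => ?_⟩
  let F : Plane → ℝ≥0∞ := fun x => powWeight s x * f x
  let G : Plane → ℝ≥0∞ := fun x => powWeight t x * g x
  have hF : Measurable F := by fun_prop
  have hG : Measurable G := by fun_prop
  let I₁ : Plane → ℝ≥0∞ := fun z => ∫⁻ x, F x * G (z - x) * smallKernel s x z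
  let I₂ : Plane → ℝ≥0∞ := fun z => ∫⁻ x, F x * G (z - x) * smallKernel t (z - x) z
  let I₃ : Plane → ℝ≥0∞ := fun z => ∫⁻ x, F x * G (z - x) * smallKernel (1 - s - t) z (z - x)
  have hI₁ : Measurable I₁ := Measurable.lintegral_prod_right (by fun_prop)
  have hI₂ : Measurable I₂ := Measurable.lintegral_prod_right (by fun_prop)
  have hpt : ∀ᵐ z : Plane, (powWeight (s + t - 1) z * ∫⁻ x, f x * g (z - x)) ^ 2 ≤
      36 * (I₁ z ^ 2 + I₂ z ^ 2 + I₃ z ^ 2) := by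
    filter_upwards [volume.ae_ne (0 : Plane)] with z hz
    have h1 : powWeight (s + t - 1) z * ∫⁻ x, f x * g (z - x) ≤ 2 * (I₁ z + I₂ z + I₃ z) := by
      calc _ = ∫⁻ x, powWeight (s + t - 1) z * (f x * g (z - x)) :=
            (lintegral_const_mul _ (by fun_prop)).symm
        _ ≤ ∫⁻ x, 2 * (F x * G (z - x) * smallKernel s x z +
              F x * G (z - x) * smallKernel t (z - x) z +
              F x * G (z - x) * smallKernel (1 - s - t) z (z - x)) := by
            refine lintegral_mono_ae ?_
            filter_upwards [volume.ae_ne (0 : Plane), volume.ae_ne z] with x hx hxz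
            have hy : z - x ≠ 0 := sub_ne_zero.2 hxz.symm
            calc _ = powWeight (s + t - 1) z * (powWeight (-s) x * powWeight (-t) (z - x)) *
                  (F x * G (z - x)) := by
                  rw [← powWeight_neg_mul_cancel hx s (f x),
                    ← powWeight_neg_mul_cancel hy t (g (z - x))]
                  ring
              _ ≤ 2 * (smallKernel s x z + smallKernel t (z - x) z +
                    smallKernel (1 - s - t) z (z - x)) * (F x * G (z - x)) := by
                  gcongr ?_ * _
                  exact powWeight_mul_mul_le hs ht hx hy hz (by abel)
              _ = _ := by ring
        _ = _ := by
            rw [lintegral_const_mul _ (by fun_prop), lintegral_add_left (by fun_prop),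
              lintegral_add_left (by fun_prop)]
    calc _ ≤ (2 * (I₁ z + I₂ z + I₃ z)) ^ 2 := by gcongr
      _ = 4 * (I₁ z + I₂ z + I₃ z) ^ 2 := by ring
      _ ≤ 4 * (9 * (I₁ z ^ 2 + I₂ z ^ 2 + I₃ z ^ 2)) := by
          gcongr; exact ENNReal.add_add_sq_le _ _ _
      _ = _ := by ring
  have hb₁ : ∫⁻ z, I₁ z ^ 2 ≤ K₁ * ((∫⁻ x, F x ^ 2) * ∫⁻ x, G x ^ 2) :=
    lintegral_sq_input_smallKernel_le hK₁' hF hG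
  have hb₂ : ∫⁻ z, I₂ z ^ 2 ≤ K₂ * ((∫⁻ x, F x ^ 2) * ∫⁻ x, G x ^ 2) := by
    have h : ∀ z, I₂ z = ∫⁻ x, G x * F (z - x) * smallKernel t x z := fun z => by
      rw [← lintegral_sub_left_eq_self _ z]
      simp only [I₂, sub_sub_cancel, mul_comm (G _)]
    simp_rw [h]
    rw [mul_comm (∫⁻ x, F x ^ 2)]
    exact lintegral_sq_input_smallKernel_le hK₂' hG hF
  have hb₃ : ∫⁻ z, I₃ z ^ 2 ≤ K₃ * ((∫⁻ x, F x ^ 2) * ∫⁻ x, G x ^ 2) :=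
    lintegral_sq_output_smallKernel_le hK₃' hF hG
  calc _ ≤ ∫⁻ z, 36 * (I₁ z ^ 2 + I₂ z ^ 2 + I₃ z ^ 2) := lintegral_mono_ae hpt
    _ = 36 * ((∫⁻ z, I₁ z ^ 2) + (∫⁻ z, I₂ z ^ 2) + ∫⁻ z, I₃ z ^ 2) := by
        rw [lintegral_const_mul' _ _ (by simp), lintegral_add_left (by fun_prop),
          lintegral_add_left (by fun_prop)]
    _ ≤ 36 * (K₁ * ((∫⁻ x, F x ^ 2) * ∫⁻ x, G x ^ 2) + K₂ * ((∫⁻ x, F x ^ 2) * ∫⁻ x, G x ^ 2) +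
          K₃ * ((∫⁻ x, F x ^ 2) * ∫⁻ x, G x ^ 2)) := by gcongr
    _ = _ := by ring

/-! ### Fourier transforms that are functions -/

theorem IsFourierFunction.ae_eq {u : 𝓢'(Plane, ℂ)} {f g : Plane → ℂ} (hf : IsFourierFunction u f)
    (hg : IsFourierFunction u g) : f =ᵐ[volume] g := by
  refine ae_eq_of_integral_contDiff_smul_eq hf.1 hg.1 fun φ hφ hφc => ?_
  have h₁ : HasCompactSupport (Complex.ofRealCLM ∘ φ) := hφc.comp_left rfl
  have h₂ : ContDiff ℝ ∞ (Complex.ofRealCLM ∘ φ) := by fun_prop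
  have h := (hf.2 (h₁.toSchwartzMap h₂) h₁).symm.trans (hg.2 (h₁.toSchwartzMap h₂) h₁)
  simpa using h

theorem isFourierFunction_fourierFunction {u : 𝓢'(Plane, ℂ)} (hu : FourierLocallyIntegrable u) :
    IsFourierFunction u (fourierFunction u) := by
  rw [fourierFunction, dif_pos hu]
  exact hu.choose_spec

theorem IsFourierFunction.fourierFunction_ae_eq {u : 𝓢'(Plane, ℂ)} {f : Plane → ℂ}
    (hf : IsFourierFunction u f) : fourierFunction u =ᵐ[volume] f :=
  (isFourierFunction_fourierFunction ⟨f, hf⟩).ae_eq hf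

theorem IsFourierFunction.congr_ae {u : 𝓢'(Plane, ℂ)} {f g : Plane → ℂ}
    (hf : IsFourierFunction u f) (hfg : f =ᵐ[volume] g) : IsFourierFunction u g := by
  refine ⟨hf.1.congr hfg, fun φ hφ => (hf.2 φ hφ).trans (integral_congr_ae ?_)⟩
  filter_upwards [hfg] with x hx
  rw [hx]

theorem powWeight_mul_enorm_sq (r : ℝ) (x : Plane) (c : ℂ) :
    (powWeight r x * ‖c‖ₑ) ^ 2 = ENNReal.ofReal (‖x‖ ^ (2 * r) * ‖c‖ ^ 2) := by
  rw [mul_pow, powWeight_sq, powWeight, ENNReal.ofReal_mul (by positivity),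
    ENNReal.ofReal_pow (norm_nonneg c), ofReal_norm]

theorem MemHomSobolev.lintegral_eq {r : ℝ} {u : 𝓢'(Plane, ℂ)} {f : Plane → ℂ}
    (hu : MemHomSobolev r u) (hf : IsFourierFunction u f) :
    ∫⁻ x, (powWeight r x * ‖f x‖ₑ) ^ 2 = ENNReal.ofReal (homSobolevNorm r u ^ 2) := by
  have h0 : 0 ≤ fun ξ : Plane => ‖ξ‖ ^ (2 * r) * ‖fourierFunction u ξ‖ ^ 2 :=
    fun ξ => by simp only [Pi.zero_apply]; positivity
  rw [homSobolevNorm, Real.sq_sqrt (integral_nonneg h0),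
    ofReal_integral_eq_lintegral_ofReal hu.2 (ae_of_all _ h0)]
  refine lintegral_congr_ae ?_
  filter_upwards [hf.fourierFunction_ae_eq] with x hx
  rw [powWeight_mul_enorm_sq, hx]

theorem IsFourierFunction.memHomSobolev {r M : ℝ} {u : 𝓢'(Plane, ℂ)} {f : Plane → ℂ}
    (hf : IsFourierFunction u f) (hM : 0 ≤ M)
    (h : ∫⁻ x, (powWeight r x * ‖f x‖ₑ) ^ 2 ≤ ENNReal.ofReal (M ^ 2)) :
    MemHomSobolev r u ∧ homSobolevNorm r u ≤ M := by
  have hmeas : AEStronglyMeasurable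
      (fun ξ : Plane => ‖ξ‖ ^ (2 * r) * ‖fourierFunction u ξ‖ ^ 2) volume := by
    have h1 : AEStronglyMeasurable (fourierFunction u) volume :=
      (isFourierFunction_fourierFunction ⟨f, hf⟩).1.aestronglyMeasurable
    have h2 : AEStronglyMeasurable (fun ξ : Plane => ‖ξ‖ ^ (2 * r)) volume :=
      (by fun_prop : Measurable fun ξ : Plane => ‖ξ‖ ^ (2 * r)).aestronglyMeasurable
    exact h2.mul (h1.norm.pow 2)
  have h0 : 0 ≤ fun ξ : Plane => ‖ξ‖ ^ (2 * r) * ‖fourierFunction u ξ‖ ^ 2 :=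
    fun ξ => by simp only [Pi.zero_apply]; positivity
  have heq : ∫⁻ ξ : Plane, ENNReal.ofReal (‖ξ‖ ^ (2 * r) * ‖fourierFunction u ξ‖ ^ 2) =
      ∫⁻ x, (powWeight r x * ‖f x‖ₑ) ^ 2 := by
    refine lintegral_congr_ae ?_
    filter_upwards [hf.fourierFunction_ae_eq] with x hx
    rw [powWeight_mul_enorm_sq, hx]
  have hint : Integrable (fun ξ : Plane => ‖ξ‖ ^ (2 * r) * ‖fourierFunction u ξ‖ ^ 2) volume := by
    refine ⟨hmeas, ?_⟩
    rw [hasFiniteIntegral_iff_ofReal (ae_of_all _ h0), heq]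
    exact h.trans_lt ENNReal.ofReal_lt_top
  refine ⟨⟨⟨f, hf⟩, hint⟩, Real.sqrt_le_iff.2 ⟨hM, ?_⟩⟩
  rw [← ENNReal.ofReal_le_ofReal_iff (sq_nonneg M),
    ofReal_integral_eq_lintegral_ofReal hint (ae_of_all _ h0), heq]
  exact h

/-! ### Functions of moderate growth as tempered distributions -/

theorem SchwartzMap.norm_apply_le_inv_one_add_norm_pow (N : ℕ) (φ : 𝓢(Plane, ℂ)) (x : Plane) :
    ‖φ x‖ ≤ ((1 + ‖x‖) ^ N)⁻¹ *
      (2 ^ N * ((Finset.Iic (N, 0)).sup (schwartzSeminormFamily ℂ Plane ℂ)) φ) := by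
  have h := SchwartzMap.one_add_le_sup_seminorm_apply (𝕜 := ℂ) (m := (N, 0)) le_rfl le_rfl φ x
  rw [norm_iteratedFDeriv_zero] at h
  rw [inv_mul_eq_div, le_div_iff₀ (by positivity), mul_comm]
  exact h

section ModerateGrowth

variable {N : ℕ} {h : Plane → ℂ}

theorem norm_schwartz_mul_le (φ : 𝓢(Plane, ℂ)) (x : Plane) :
    ‖φ x * h x‖ ≤ 2 ^ N * ((Finset.Iic (N, 0)).sup (schwartzSeminormFamily ℂ Plane ℂ)) φ *
      ‖((1 + ‖x‖) ^ N)⁻¹ • h x‖ := by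
  rw [norm_mul, norm_smul, norm_inv, norm_pow, Real.norm_of_nonneg (by positivity : 0 ≤ 1 + ‖x‖)]
  calc _ ≤ ((1 + ‖x‖) ^ N)⁻¹ *
      (2 ^ N * ((Finset.Iic (N, 0)).sup (schwartzSeminormFamily ℂ Plane ℂ)) φ) * ‖h x‖ := by
        gcongr; exact φ.norm_apply_le_inv_one_add_norm_pow N x
    _ = _ := by ring

theorem one_add_norm_pow_smul_inv_smul (N : ℕ) (h : Plane → ℂ) (x : Plane) :
    (1 + ‖x‖) ^ N • ((1 + ‖x‖) ^ N)⁻¹ • h x = h x :=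
  smul_inv_smul₀ (by positivity) _

theorem aestronglyMeasurable_of_inv_one_add_norm_pow_smul
    (hh : Integrable (fun x => ((1 + ‖x‖) ^ N)⁻¹ • h x)) : AEStronglyMeasurable h volume := by
  have h1 : Continuous fun x : Plane => (1 + ‖x‖) ^ N := by fun_prop
  exact (h1.aestronglyMeasurable.smul hh.1).congr
    (ae_of_all _ (one_add_norm_pow_smul_inv_smul N h))

theorem integrable_schwartz_mul (hh : Integrable (fun x => ((1 + ‖x‖) ^ N)⁻¹ • h x))
    (φ : 𝓢(Plane, ℂ)) : Integrable (fun x => φ x * h x) :=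
  (hh.norm.const_mul _).mono'
    (φ.continuous.aestronglyMeasurable.mul (aestronglyMeasurable_of_inv_one_add_norm_pow_smul hh))
    (ae_of_all _ (norm_schwartz_mul_le φ))

theorem locallyIntegrable_of_inv_one_add_norm_pow_smul
    (hh : Integrable (fun x => ((1 + ‖x‖) ^ N)⁻¹ • h x)) : LocallyIntegrable h volume := by
  have h1 : Continuous fun x : Plane => (1 + ‖x‖) ^ N := by fun_prop
  have h2 := hh.locallyIntegrable.locallyIntegrableOn Set.univ
  have h3 := LocallyIntegrableOn.continuousOn_smul isOpen_univ.isLocallyClosed h2 h1.continuousOn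
  simpa only [one_add_norm_pow_smul_inv_smul, locallyIntegrableOn_univ] using h3

/-- A function `h` with `(1 + ‖x‖) ^ (-N) * h` integrable defines a tempered distribution. -/
theorem exists_temperedDistribution_eq_integral
    (hh : Integrable (fun x => ((1 + ‖x‖) ^ N)⁻¹ • h x)) :
    ∃ T : 𝓢'(Plane, ℂ), ∀ φ : 𝓢(Plane, ℂ), T φ = ∫ x, φ x * h x := by
  let T : 𝓢(Plane, ℂ) →L[ℂ] ℂ :=
    SchwartzMap.mkCLMtoNormedSpace (fun φ => ∫ x, φ x * h x)
      (fun φ ψ => by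
        simp only [_root_.add_apply, add_mul]
        exact integral_add (integrable_schwartz_mul hh φ) (integrable_schwartz_mul hh ψ))
      (fun c φ => by
        simp only [_root_.smul_apply, smul_mul_assoc, RingHom.id_apply]
        exact integral_smul c _)
      ⟨Finset.Iic (N, 0), 2 ^ N * ∫ x, ‖((1 + ‖x‖) ^ N)⁻¹ • h x‖, by positivity, fun φ => by
        calc _ ≤ ∫ x, 2 ^ N * ((Finset.Iic (N, 0)).sup (schwartzSeminormFamily ℂ Plane ℂ)) φ *
              ‖((1 + ‖x‖) ^ N)⁻¹ • h x‖ :=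
              norm_integral_le_of_norm_le (hh.norm.const_mul _)
                (ae_of_all _ (norm_schwartz_mul_le φ))
          _ = _ := by rw [integral_const_mul]; ring⟩
  exact ⟨T, fun φ => rfl⟩

end ModerateGrowth

/-- Weighted `L²` functions have moderate growth: by Cauchy–Schwarz it is enough that
`‖x‖ ^ (-2 * r) * (1 + ‖x‖) ^ (-6)` is integrable on the plane, near the origin because `r < 1` and
at infinity because `-1 < r`. -/
theorem lintegral_inv_one_add_norm_pow_mul_lt_top {r : ℝ} (hr₁ : -1 < r) (hr₂ : r < 1)
    {k : Plane → ℝ≥0∞} (hk : Measurable k) (hk' : ∫⁻ x, (powWeight r x * k x) ^ 2 < ⊤) :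
    ∫⁻ x, ENNReal.ofReal ((1 + ‖x‖) ^ 3)⁻¹ * k x < ⊤ := by
  have hw : Measurable fun x : Plane => ENNReal.ofReal ((1 + ‖x‖) ^ 3)⁻¹ := by fun_prop
  have hsq : (∫⁻ x, ENNReal.ofReal ((1 + ‖x‖) ^ 3)⁻¹ * k x) ^ 2 < ⊤ := by
    calc _ = (∫⁻ x, (powWeight (-r) x * ENNReal.ofReal ((1 + ‖x‖) ^ 3)⁻¹) *
          (powWeight r x * k x)) ^ 2 := by
          congr 1
          refine lintegral_congr_ae ?_
          filter_upwards [volume.ae_ne (0 : Plane)] with x hx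
          nth_rw 1 [← powWeight_neg_mul_cancel hx r (k x)]
          ring
      _ ≤ _ := lintegral_mul_sq_le (by fun_prop) (by fun_prop)
      _ < ⊤ := ENNReal.mul_lt_top ?_ hk'
    calc _ ≤ ∫⁻ x : Plane, (Metric.closedBall 0 1).indicator (powWeight (2 * -r)) x +
          ENNReal.ofReal ((1 + ‖x‖) ^ (-4 : ℝ)) := by
          refine lintegral_mono fun x => ?_
          simp only
          rw [mul_pow, powWeight_sq]
          have h1 : 0 < 1 + ‖x‖ := by positivity
          have h2 : (1 : ℝ) ≤ 1 + ‖x‖ := by linarith [norm_nonneg x]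
          by_cases hx : ‖x‖ ≤ 1
          · have hx' : x ∈ Metric.closedBall (0 : Plane) 1 := by simpa using hx
            rw [Set.indicator_of_mem hx']
            refine le_add_right (mul_le_of_le_one_right' (pow_le_one' ?_ 2))
            rw [ENNReal.ofReal_le_one]
            exact inv_le_one_of_one_le₀ (one_le_pow₀ h2)
          · refine le_add_left ?_
            rw [powWeight, ← ENNReal.ofReal_pow (by positivity),
              ← ENNReal.ofReal_mul (by positivity)]
            refine ENNReal.ofReal_le_ofReal ?_
            have h3 : ‖x‖ ^ (2 * -r) ≤ (1 + ‖x‖) ^ 2 := by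
              calc _ ≤ ‖x‖ ^ (2 : ℝ) :=
                    Real.rpow_le_rpow_of_exponent_le (not_le.1 hx).le (by linarith)
                _ = ‖x‖ ^ 2 := Real.rpow_ofNat _ _
                _ ≤ _ := by gcongr; linarith
            calc _ ≤ (1 + ‖x‖) ^ 2 * (((1 + ‖x‖) ^ 3)⁻¹) ^ 2 := by gcongr
              _ = _ := by
                rw [Real.rpow_neg h1.le, Real.rpow_ofNat]
                field_simp
      _ < ⊤ := by
          rw [lintegral_add_right _ (by fun_prop),
            lintegral_indicator Metric.isClosed_closedBall.measurableSet]
          refine ENNReal.add_lt_top.2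
            ⟨setLIntegral_closedBall_powWeight_lt_top (by linarith), ?_⟩
          exact (integrable_one_add_norm (by simp; norm_num)).lintegral_lt_top
  exact lt_top_iff_ne_top.2 fun h => by simp [h] at hsq

/-! ### Convergence of the truncated products -/

/-- Self-adjointness of `𝓕⁻`, combined with `𝓕⁻ f * 𝓕⁻ g = 𝓕⁻ (f ∗ g)`. -/
theorem integral_mul_fourierInv_mul_fourierInv {f g : Plane → ℂ} (hf : Integrable f)
    (hg : Integrable g) (φ : 𝓢(Plane, ℂ)) :
    ∫ x, φ x * (𝓕⁻ f x * 𝓕⁻ g x) =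
      ∫ ξ, (𝓕⁻ φ : 𝓢(Plane, ℂ)) ξ * ∫ x, f x * g (ξ - x) := by
  let c : Plane → ℂ := convolution f g (ContinuousLinearMap.mul ℂ ℂ) volume
  have hc : Integrable c := hf.integrable_convolution _ hg
  have h₁ (x : Plane) : 𝓕⁻ f x * 𝓕⁻ g x = 𝓕⁻ c x := by
    simp only [Real.fourierInv_eq_fourier_neg]
    exact (Real.fourier_mul_convolution_eq hf hg (-x)).symm
  have hflip : (-innerₗ Plane).flip = -innerₗ Plane := by
    ext x y
    simp [real_inner_comm]
  have h₂ := VectorFourier.integral_fourierIntegral_smul_eq_flip (L := -innerₗ Plane)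
    Real.continuous_fourierChar (by simpa using! continuous_inner.neg)
    (φ.integrable (μ := volume)) hc
  rw [hflip] at h₂
  simp_rw [h₁, SchwartzMap.fourierInv_coe]
  exact h₂.symm

theorem integrable_inv_one_add_norm_pow_smul {N : ℕ} {h : Plane → ℂ} {k : Plane → ℝ≥0∞}
    (hh : AEStronglyMeasurable h volume) (hle : ∀ x, ‖h x‖ₑ ≤ k x)
    (hk : ∫⁻ x, ENNReal.ofReal ((1 + ‖x‖) ^ N)⁻¹ * k x < ⊤) :
    Integrable (fun x => ((1 + ‖x‖) ^ N)⁻¹ • h x) := by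
  have h1 : Measurable fun x : Plane => ((1 + ‖x‖) ^ N)⁻¹ := by fun_prop
  refine ⟨h1.aestronglyMeasurable.smul hh, (lintegral_mono fun x => ?_).trans_lt hk⟩
  rw [enorm_smul, Real.enorm_of_nonneg (by positivity)]
  gcongr
  exact hle x

theorem IsFrequencyCutoff.exists_bound {χ : Plane → ℝ} (hχ : IsFrequencyCutoff χ) :
    ∃ M : ℝ, 0 ≤ M ∧ ∀ x, ‖χ x‖ ≤ M := by
  obtain ⟨M, hM⟩ := hχ.hasCompactSupport.exists_bound_of_continuous hχ.contDiff.continuous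
  exact ⟨M, (norm_nonneg _).trans (hM 0), hM⟩

theorem IsFrequencyCutoff.tendsto_dilation {χ : Plane → ℝ} (hχ : IsFrequencyCutoff χ) (x : Plane) :
    Tendsto (fun j : ℕ => (χ ((2 : ℝ)⁻¹ ^ j • x) : ℂ)) atTop (𝓝 1) := by
  have h : Tendsto (fun j : ℕ => (2 : ℝ)⁻¹ ^ j • x) atTop (𝓝 0) := by
    simpa using (tendsto_pow_atTop_nhds_zero_of_lt_one (by norm_num : (0 : ℝ) ≤ 2⁻¹)
      (by norm_num)).smul_const x
  refine tendsto_const_nhds.congr' ?_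
  filter_upwards [h.eventually hχ.eventually_eq_one] with j hj
  rw [hj, Complex.ofReal_one]

theorem IsFrequencyCutoff.integrable_dilation_mul {χ : Plane → ℝ} (hχ : IsFrequencyCutoff χ) (j : ℕ)
    {f : Plane → ℂ} (hf : LocallyIntegrable f volume) :
    Integrable fun x => (χ ((2 : ℝ)⁻¹ ^ j • x) : ℂ) * f x := by
  have h := hf.integrable_smul_left_of_hasCompactSupport
    (g := fun x => χ ((2 : ℝ)⁻¹ ^ j • x)) (hχ.contDiff.continuous.comp (by fun_prop))
    (hχ.hasCompactSupport.comp_smul (by positivity))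
  simpa using h

/-- Two applications of dominated convergence, first in the convolution integral and then in the
pairing with `ψ`. -/
theorem tendsto_integral_schwartz_mul_truncated_convolution {N : ℕ} {f g : Plane → ℂ}
    (hf : StronglyMeasurable f) (hg : StronglyMeasurable g)
    (hfg : ∫⁻ ξ, ENNReal.ofReal ((1 + ‖ξ‖) ^ N)⁻¹ * ∫⁻ x, ‖f x‖ₑ * ‖g (ξ - x)‖ₑ < ⊤)
    {χ : Plane → ℝ} (hχ : IsFrequencyCutoff χ) (ψ : 𝓢(Plane, ℂ)) :
    Tendsto (fun j : ℕ => ∫ ξ, ψ ξ * ∫ x, ((χ ((2 : ℝ)⁻¹ ^ j • x) : ℂ) * f x) *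
      ((χ ((2 : ℝ)⁻¹ ^ j • (ξ - x)) : ℂ) * g (ξ - x))) atTop
      (𝓝 (∫ ξ, ψ ξ * ∫ x, f x * g (ξ - x))) := by
  obtain ⟨M, hM0, hM⟩ := hχ.exists_bound
  have hχc : Continuous χ := hχ.contDiff.continuous
  have hfm := hf.measurable
  have hgm := hg.measurable
  have hχm := hχc.measurable
  have hbound (j : ℕ) (ξ x : Plane) : ‖((χ ((2 : ℝ)⁻¹ ^ j • x) : ℂ) * f x) *
      ((χ ((2 : ℝ)⁻¹ ^ j • (ξ - x)) : ℂ) * g (ξ - x))‖ ≤ M ^ 2 * ‖f x * g (ξ - x)‖ := by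
    simp only [norm_mul, Complex.norm_real]
    calc _ ≤ (M * ‖f x‖) * (M * ‖g (ξ - x)‖) := by gcongr <;> exact hM _
      _ = _ := by ring
  let H : Plane → ℂ := fun ξ => ((∫ x, ‖f x * g (ξ - x)‖ : ℝ) : ℂ)
  have hHm : StronglyMeasurable H := by
    refine Complex.continuous_ofReal.comp_stronglyMeasurable
      (StronglyMeasurable.integral_prod_right ?_)
    exact Measurable.stronglyMeasurable (by fun_prop)
  have hH : Integrable (fun ξ => ψ ξ * H ξ) := by
    refine integrable_schwartz_mul (integrable_inv_one_add_norm_pow_smul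
      hHm.aestronglyMeasurable (fun ξ => ?_) hfg) ψ
    simp only [H]
    rw [← ofReal_norm, Complex.norm_real, ofReal_norm]
    refine (enorm_integral_le_lintegral_enorm _).trans_eq ?_
    simp [enorm_mul]
  -- The convolution integral converges absolutely for almost every frequency.
  have hae : ∀ᵐ ξ : Plane, Integrable fun x => f x * g (ξ - x) := by
    filter_upwards [ae_lt_top (by fun_prop) hfg.ne] with ξ hξ
    refine ⟨(by fun_prop : Measurable fun x => f x * g (ξ - x)).aestronglyMeasurable, ?_⟩
    have h0 : ENNReal.ofReal ((1 + ‖ξ‖) ^ N)⁻¹ ≠ 0 := by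
      rw [Ne, ENNReal.ofReal_eq_zero, not_le]; positivity
    simpa [HasFiniteIntegral, enorm_mul] using (ENNReal.lt_top_of_mul_ne_top_right hξ.ne h0)
  refine tendsto_integral_of_dominated_convergence (fun ξ => M ^ 2 * ‖ψ ξ * H ξ‖) (fun j => ?_)
    (hH.norm.const_mul _) (fun j => ?_) ?_
  · refine ψ.continuous.aestronglyMeasurable.mul
      (StronglyMeasurable.integral_prod_right ?_).aestronglyMeasurable
    exact Measurable.stronglyMeasurable (by fun_prop)
  · filter_upwards [hae] with ξ hξ
    have h1 : ‖∫ x, ((χ ((2 : ℝ)⁻¹ ^ j • x) : ℂ) * f x) *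
        ((χ ((2 : ℝ)⁻¹ ^ j • (ξ - x)) : ℂ) * g (ξ - x))‖ ≤ M ^ 2 * ‖H ξ‖ := by
      simp only [H, Complex.norm_real]
      rw [Real.norm_of_nonneg (integral_nonneg fun x => norm_nonneg _), ← integral_const_mul]
      exact norm_integral_le_of_norm_le (hξ.norm.const_mul _) (ae_of_all _ (hbound j ξ))
    rw [norm_mul, norm_mul]
    calc _ ≤ ‖ψ ξ‖ * (M ^ 2 * ‖H ξ‖) := by gcongr
      _ = _ := by ring
  · filter_upwards [hae] with ξ hξ
    refine Tendsto.const_mul _ ?_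
    refine tendsto_integral_of_dominated_convergence (fun x => M ^ 2 * ‖f x * g (ξ - x)‖)
      (fun j => ?_) (hξ.norm.const_mul _) (fun j => ae_of_all _ (hbound j ξ))
      (ae_of_all _ fun x => ?_)
    · exact Measurable.aestronglyMeasurable (by fun_prop)
    · simpa using ((hχ.tendsto_dilation x).mul_const (f x)).mul
        ((hχ.tendsto_dilation (ξ - x)).mul_const (g (ξ - x)))

/-! ### The product law -/

theorem mainTheorem4 (s t : ℝ) (hs : |s| < 1) (ht : |t| < 1) (hst : 0 < s + t) :
    ∃ C : ℝ, 0 < C ∧ ∀ a b : 𝓢'(Plane, ℂ), MemHomSobolev s a → MemHomSobolev t b →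
      ∃ ab : 𝓢'(Plane, ℂ), IsDistribProduct a b ab ∧ MemHomSobolev (s + t - 1) ab ∧
        homSobolevNorm (s + t - 1) ab ≤ C * homSobolevNorm s a * homSobolevNorm t b := by
  obtain ⟨K, hK, hconv⟩ := exists_lintegral_powWeight_convolution_le hs ht hst
  refine ⟨Real.sqrt K.toReal + 1, by positivity, fun a b ha hb => ?_⟩
  have hNa : 0 ≤ homSobolevNorm s a := Real.sqrt_nonneg _
  have hNb : 0 ≤ homSobolevNorm t b := Real.sqrt_nonneg _
  -- Strongly measurable representatives of the two Fourier transforms.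
  obtain ⟨f, hfm, hfa⟩ := (isFourierFunction_fourierFunction ha.1).1.aestronglyMeasurable
  obtain ⟨g, hgm, hgb⟩ := (isFourierFunction_fourierFunction hb.1).1.aestronglyMeasurable
  have hf := (isFourierFunction_fourierFunction ha.1).congr_ae hfa
  have hg := (isFourierFunction_fourierFunction hb.1).congr_ae hgb
  have hfm' := hfm.measurable
  have hgm' := hgm.measurable
  -- The absolute convolution dominates the Fourier transform of the product and, up to a constant,
  -- those of the truncated products.
  let k : Plane → ℝ≥0∞ := fun ξ => ∫⁻ x, ‖f x‖ₑ * ‖g (ξ - x)‖ₑ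
  have hkm : Measurable k := Measurable.lintegral_prod_right (by fun_prop)
  have hk : ∫⁻ ξ, (powWeight (s + t - 1) ξ * k ξ) ^ 2 ≤
      ENNReal.ofReal (((Real.sqrt K.toReal + 1) * homSobolevNorm s a * homSobolevNorm t b) ^ 2) := by
    refine (hconv (fun x => ‖f x‖ₑ) (fun x => ‖g x‖ₑ) (by fun_prop) (by fun_prop)).trans ?_
    rw [ha.lintegral_eq hf, hb.lintegral_eq hg, ← ENNReal.ofReal_toReal hK,
      ← ENNReal.ofReal_mul (by positivity), ← ENNReal.ofReal_mul (by positivity),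
      ENNReal.toReal_ofReal (by positivity)]
    refine ENNReal.ofReal_le_ofReal ?_
    have h1 : K.toReal ≤ (Real.sqrt K.toReal + 1) ^ 2 := by
      nlinarith [Real.sq_sqrt (ENNReal.toReal_nonneg (a := K)), Real.sqrt_nonneg K.toReal]
    calc _ ≤ (Real.sqrt K.toReal + 1) ^ 2 * (homSobolevNorm s a ^ 2 * homSobolevNorm t b ^ 2) := by
          gcongr
      _ = _ := by ring
  have hfin := lintegral_inv_one_add_norm_pow_mul_lt_top (by linarith)
    (by linarith [(abs_lt.1 hs).2, (abs_lt.1 ht).2]) hkm (hk.trans_lt ENNReal.ofReal_lt_top)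
  let h : Plane → ℂ := fun ξ => ∫ x, f x * g (ξ - x)
  have hhm : StronglyMeasurable h :=
    StronglyMeasurable.integral_prod_right (Measurable.stronglyMeasurable (by fun_prop))
  have hhk (ξ : Plane) : ‖h ξ‖ₑ ≤ k ξ :=
    (enorm_integral_le_lintegral_enorm _).trans_eq (by simp [k, enorm_mul])
  have hhi := integrable_inv_one_add_norm_pow_smul hhm.aestronglyMeasurable hhk hfin
  obtain ⟨T, hT⟩ := exists_temperedDistribution_eq_integral hhi
  have hFT : IsFourierFunction (𝓕⁻ T) h :=
    ⟨locallyIntegrable_of_inv_one_add_norm_pow_smul hhi, fun φ _ => by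
      rw [FourierTransform.fourier_fourierInv_eq, hT]⟩
  refine ⟨𝓕⁻ T, ⟨ha.1, hb.1, fun χ hχ φ => ?_⟩,
    hFT.memHomSobolev (by positivity) (le_trans ?_ hk)⟩
  · rw [TemperedDistribution.fourierInv_apply, hT]
    refine (tendsto_integral_schwartz_mul_truncated_convolution hfm hgm hfin hχ (𝓕⁻ φ)).congr
      fun j => ?_
    rw [← integral_mul_fourierInv_mul_fourierInv (hχ.integrable_dilation_mul j hf.1)
      (hχ.integrable_dilation_mul j hg.1)]
    refine integral_congr_ae (ae_of_all _ fun x => ?_)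
    have ha' : lowFrequency χ j a x = 𝓕⁻ (fun ξ => (χ ((2 : ℝ)⁻¹ ^ j • ξ) : ℂ) * f ξ) x := by
      refine Real.fourierInv_congr_ae ?_ x
      filter_upwards [hfa] with ξ hξ
      rw [hξ]
    have hb' : lowFrequency χ j b x = 𝓕⁻ (fun ξ => (χ ((2 : ℝ)⁻¹ ^ j • ξ) : ℂ) * g ξ) x := by
      refine Real.fourierInv_congr_ae ?_ x
      filter_upwards [hgb] with ξ hξ
      rw [hξ]
    simp only [ha', hb']
  · refine lintegral_mono fun ξ => ?_
    gcongr
    exact hhk ξ
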